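/- Let $(M,g_M)$ and $(N,g_N)$ be smooth (finite-dimensional, boundaryless) Riemannian manifolds, and let $M\times N$ carry the product metric, given on $T_{(p,q)}(M\times N)=T_pM\oplus T_qN$ by $$g_{M\times N}\big((v_1,w_1),(v_2,w_2)\big)=g_M(v_1,v_2)+g_N(w_1,w_2).$$ For a Riemannian manifold and linearly independent tangent vectors $x,y$ at a point, the sectional curvature of the plane they span is $$\sec(x\wedge y)=\frac{\langle R(x,y)y,x\rangle}{|x|^2|y|^2-\langle x,y\rangle^2},$$ where $R(X,Y)Z=\nabla_X\nabla_YZ-\nabla_Y\nabla_XZ-\nabla_{[X,Y]}Z$ is the Riemannian curvature tensor of the Levi-Civita connection $\nabla$. Let $\kappa_M,\kappa_N\ge 0$ be real numbers such that $\sec_M\le\kappa_M$ and $\sec_N\le\kappa_N$, i.e. every tangent plane of $M$ (of $N$) has sectional curvature at most $\kappa_M$ (at most $\kappa_N$). Then every tangent plane of $M\times N$ with the product metric has sectional curvature at most $\max(\kappa_M,\kappa_N)$. -/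

import Mathlib

open scoped Manifold ContDiff Topology

noncomputable section

namespace RiemannianProduct

variable
  {E : Type*} [NormedAddCommGroup E] [NormedSpace ℝ E]
  {H : Type*} [TopologicalSpace H] {I : ModelWithCorners ℝ E H}
  {M : Type*} [TopologicalSpace M] [ChartedSpace H M] [IsManifold I ∞ M]
  {F : Type*} [NormedAddCommGroup F] [NormedSpace ℝ F]
  {K : Type*} [TopologicalSpace K] {J : ModelWithCorners ℝ F K}
  {N : Type*} [TopologicalSpace N] [ChartedSpace K N] [IsManifold J ∞ N]

variable (I M) in
/-- Smooth Riemannian metrics on the manifold `M`: smoothly varying inner products on the tangent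
spaces. -/
abbrev SmoothMetric : Type _ :=
  Bundle.ContMDiffRiemannianMetric I ∞ E (fun x : M ↦ TangentSpace I x)

/-! ### The Riemannian curvature tensor and the sectional curvature

On an open subset of the vector space `E`, a metric is a map `G` from `E` to bilinear forms, and
its Levi-Civita connection is `∇_v Z = D_v Z + Γ(v, Z)`, where `Γ` is given by the Christoffel
symbols. The curvature of a Riemannian manifold at a point `p` is computed in the chart at `p`. -/

/-- Christoffel symbols (of the second kind) of the metric `G`: `Γ_u(v, w)` is the vector with
`2 G_u(Γ_u(v, w), z) = (D_v G)(w, z) + (D_w G)(v, z) - (D_z G)(v, w)` for all `z`. -/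
def christoffel (G : E → E →L[ℝ] E →L[ℝ] ℝ) (u v w : E) : E :=
  (G u).inverse ((1 / 2 : ℝ) •
    (fderiv ℝ G u v w + fderiv ℝ G u w v - ((fderiv ℝ G u).flip v).flip w))

/-- The curvature tensor `R(v, w) z = ∇_v ∇_w z - ∇_w ∇_v z` of the metric `G`, for constant
vector fields `v, w, z` (so that `[v, w] = 0`). -/
def coordCurvature (G : E → E →L[ℝ] E →L[ℝ] ℝ) (u v w z : E) : E :=
  fderiv ℝ (fun u' ↦ christoffel G u' w z) u v - fderiv ℝ (fun u' ↦ christoffel G u' v z) u w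
    + christoffel G u v (christoffel G u w z) - christoffel G u w (christoffel G u v z)

/-- The metric `g` in the chart `φ` at `p`: at the point `u` in the image of the chart it is the
form `(v, w) ↦ g_x (dφ⁻¹_u v, dφ⁻¹_u w)` with `x = φ⁻¹ u`. (As a type, `TangentSpace I x` is `E`.) -/
def coordMetric (g : SmoothMetric I M) (p : M) (u : E) : E →L[ℝ] E →L[ℝ] ℝ :=
  let x : M := (extChartAt I p).symm u
  let d : E →L[ℝ] TangentSpace I x := mfderiv 𝓘(ℝ, E) I (extChartAt I p).symm u
  ContinuousLinearMap.bilinearComp (E := E) (F := E) (g.inner x) d d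

/-- The Riemannian curvature tensor of `(M, g)` at `p`, evaluated on four tangent vectors:
`⟨R(v, w) z, t⟩`, computed in the chart `φ` at `p` after transporting the vectors by `dφ_p`. -/
def curvatureForm (g : SmoothMetric I M) (p : M) (v w z t : TangentSpace I p) : ℝ :=
  let d : TangentSpace I p →L[ℝ] E := mfderiv I 𝓘(ℝ, E) (extChartAt I p) p
  coordMetric g p (extChartAt I p p)
    (coordCurvature (coordMetric g p) (extChartAt I p p) (d v) (d w) (d z)) (d t)

/-- The squared area `|v ∧ w|² = |v|² |w|² - ⟨v, w⟩²` of the parallelogram spanned by `v, w`. -/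
def areaSq (g : SmoothMetric I M) (p : M) (v w : TangentSpace I p) : ℝ :=
  g.inner p v v * g.inner p w w - g.inner p v w ^ 2

/-- The sectional curvature `⟨R(v, w) w, v⟩ / |v ∧ w|²` of the plane spanned by the linearly
independent tangent vectors `v, w` at `p`. -/
def sectionalCurvature (g : SmoothMetric I M) (p : M) (v w : TangentSpace I p) : ℝ :=
  curvatureForm g p v w w v / areaSq g p v w

/-- `sec ≤ κ`: at every point, every tangent plane has sectional curvature at most `κ`. -/
def SectionalCurvatureLE (g : SmoothMetric I M) (κ : ℝ) : Prop :=
  ∀ (p : M) (v w : TangentSpace I p), LinearIndependent ℝ ![v, w] → sectionalCurvature g p v w ≤ κ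

/-! ### The product metric -/

/-- The bilinear form `((v₁, w₁), (v₂, w₂)) ↦ a (v₁, v₂) + b (w₁, w₂)` on `E × F`. -/
def sumForm (a : E →L[ℝ] E →L[ℝ] ℝ) (b : F →L[ℝ] F →L[ℝ] ℝ) : E × F →L[ℝ] E × F →L[ℝ] ℝ :=
  a.bilinearComp (ContinuousLinearMap.fst ℝ E F) (ContinuousLinearMap.fst ℝ E F) +
    b.bilinearComp (ContinuousLinearMap.snd ℝ E F) (ContinuousLinearMap.snd ℝ E F)

theorem sumForm_apply (a : E →L[ℝ] E →L[ℝ] ℝ) (b : F →L[ℝ] F →L[ℝ] ℝ) (v w : E × F) :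
    sumForm a b v w = a v.1 w.1 + b v.2 w.2 := rfl

theorem contDiff_bilinearComp {n : ℕ∞ω} (p : F →L[ℝ] E) :
    ContDiff ℝ n (fun a : E →L[ℝ] E →L[ℝ] ℝ ↦ a.bilinearComp p p) := by
  have h : (fun a : E →L[ℝ] E →L[ℝ] ℝ ↦ a.bilinearComp p p) =
      fun a ↦ ((ContinuousLinearMap.compL ℝ F E ℝ).flip p).comp (a.comp p) := rfl
  rw [h]
  exact contDiff_const.clm_comp (contDiff_id.clm_comp contDiff_const)

theorem contDiff_sumForm {n : ℕ∞ω} :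
    ContDiff ℝ n (fun c : (E →L[ℝ] E →L[ℝ] ℝ) × (F →L[ℝ] F →L[ℝ] ℝ) ↦ sumForm c.1 c.2) :=
  ((contDiff_bilinearComp _).comp contDiff_fst).add ((contDiff_bilinearComp _).comp contDiff_snd)

/-- In the tangent bundle trivializations, the tangent bundle of a product is the product of the
tangent bundles. -/
theorem symmL_trivializationAt_prod {x₀ x : M} {y₀ y : N}
    (hx : x ∈ (chartAt H x₀).source) (hy : y ∈ (chartAt K y₀).source) :
    (trivializationAt (E × F) (TangentSpace (I.prod J)) (x₀, y₀)).symmL ℝ (x, y) =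
      (((trivializationAt E (TangentSpace I) x₀).symmL ℝ x : E →L[ℝ] E).prodMap
        ((trivializationAt F (TangentSpace J) y₀).symmL ℝ y : F →L[ℝ] F) : E × F →L[ℝ] E × F) := by
  have h1 := TangentBundle.symmL_trivializationAt_eq_core (I := I.prod J) (b₀ := (x₀, y₀))
    (b := (x, y)) (by simp [hx, hy])
  have h2 := TangentBundle.symmL_trivializationAt_eq_core (I := I) hx
  have h3 := TangentBundle.symmL_trivializationAt_eq_core (I := J) hy
  rw [h1, h2, h3]
  simp only [tangentBundleCore_coordChange_achart, extChartAt_prod]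
  have hx' : DifferentiableWithinAt ℝ (extChartAt I x ∘ (extChartAt I x₀).symm) (Set.range I)
      (extChartAt I x₀ x) :=
    ((contDiffWithinAt_ext_coord_change (n := 1) x x₀ (by simp [hx])).differentiableWithinAt
      one_ne_zero)
  have hy' : DifferentiableWithinAt ℝ (extChartAt J y ∘ (extChartAt J y₀).symm) (Set.range J)
      (extChartAt J y₀ y) :=
    ((contDiffWithinAt_ext_coord_change (n := 1) y y₀ (by simp [hy])).differentiableWithinAt
      one_ne_zero)
  have hr : Set.range (I.prod J) = Set.range I ×ˢ Set.range J := ModelWithCorners.range_prod ..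
  rw [hr]
  refine HasFDerivWithinAt.fderivWithin (f := Prod.map (extChartAt I x ∘ (extChartAt I x₀).symm)
    (extChartAt J y ∘ (extChartAt J y₀).symm)) ?_ ?_
  · refine HasFDerivWithinAt.prodMap (p := (extChartAt I x₀ x, extChartAt J y₀ y)) ?_ ?_
    · exact hx'.hasFDerivWithinAt.mono (Set.fst_image_prod_subset _ _)
    · exact hy'.hasFDerivWithinAt.mono (Set.snd_image_prod_subset _ _)
  · exact UniqueDiffWithinAt.prod (I.uniqueDiffOn _ (by simp)) (J.uniqueDiffOn _ (by simp))

/-- The coordinate expression of a field of bilinear forms in the trivialization around `x₀`. -/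
theorem trivializationAt_form_apply {x₀ x : M} (hx : x ∈ (chartAt H x₀).source)
    (b : TangentSpace I x →L[ℝ] TangentSpace I x →L[ℝ] ℝ) (v w : E) :
    (trivializationAt (E →L[ℝ] E →L[ℝ] ℝ)
        (fun x : M ↦ TangentSpace I x →L[ℝ] TangentSpace I x →L[ℝ] ℝ) x₀ ⟨x, b⟩).2 v w =
      b ((trivializationAt E (TangentSpace I) x₀).symmL ℝ x v)
        ((trivializationAt E (TangentSpace I) x₀).symmL ℝ x w) := by
  have hx' : x ∈ (trivializationAt E (TangentSpace I : M → Type _) x₀).baseSet := by simpa using hx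
  rw [hom_trivializationAt_apply]
  have := inCoordinates_apply_eq₂ (E₃ := Bundle.Trivial M ℝ) (F₃ := ℝ) (x₀ := x₀) (ϕ := b)
    (v := v) (w := w) hx' hx' (Set.mem_univ _)
  refine this.trans ?_
  erw [Bundle.Trivial.linearMapAt_trivialization]
  rw [Bundle.Trivialization.symmL_apply _ hx', Bundle.Trivialization.symmL_apply _ hx']
  rfl

/-- The product form `((v₁, w₁), (v₂, w₂)) ↦ g_p (v₁, v₂) + h_q (w₁, w₂)` on
`T_(p,q) (M × N) = T_p M × T_q N`. -/
def productInner (g : SmoothMetric I M) (h : SmoothMetric J N) (b : M × N) :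
    TangentSpace (I.prod J) b →L[ℝ] TangentSpace (I.prod J) b →L[ℝ] ℝ :=
  sumForm (E := E) (F := F) (g.inner b.1) (h.inner b.2)

theorem productInner_apply (g : SmoothMetric I M) (h : SmoothMetric J N) (b : M × N)
    (v w : TangentSpace (I.prod J) b) :
    productInner g h b v w = g.inner b.1 v.1 w.1 + h.inner b.2 v.2 w.2 := rfl

theorem metric_self_nonneg (g : SmoothMetric I M) (x : M) (u : TangentSpace I x) :
    0 ≤ g.inner x u u := by
  by_cases hu : u = 0
  · simp [hu]
  · exact (g.pos x u hu).le

theorem isVonNBounded_productInner (g : SmoothMetric I M) (h : SmoothMetric J N) (b : M × N) :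
    Bornology.IsVonNBounded ℝ {v : TangentSpace (I.prod J) b | productInner g h b v v < 1} := by
  have h1 : Bornology.IsBounded (α := E) {v | g.inner b.1 v v < 1} :=
    (NormedSpace.isVonNBounded_iff ℝ (E := E)).1 (g.isVonNBounded b.1)
  have h2 : Bornology.IsBounded (α := F) {v | h.inner b.2 v v < 1} :=
    (NormedSpace.isVonNBounded_iff ℝ (E := F)).1 (h.isVonNBounded b.2)
  refine (NormedSpace.isVonNBounded_iff ℝ (E := E × F)).2 ((h1.prod h2).subset ?_)
  intro v hv
  have hv' : g.inner b.1 v.1 v.1 + h.inner b.2 v.2 v.2 < 1 := hv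
  have h3 := metric_self_nonneg g b.1 v.1
  have h4 := metric_self_nonneg h b.2 v.2
  exact ⟨show g.inner b.1 v.1 v.1 < 1 by linarith, show h.inner b.2 v.2 v.2 < 1 by linarith⟩

theorem contMDiff_productInner (g : SmoothMetric I M) (h : SmoothMetric J N) :
    ContMDiff (I.prod J) ((I.prod J).prod 𝓘(ℝ, E × F →L[ℝ] E × F →L[ℝ] ℝ)) ∞
      (fun b : M × N ↦ Bundle.TotalSpace.mk' (E × F →L[ℝ] E × F →L[ℝ] ℝ)
        (E := fun b : M × N ↦ TangentSpace (I.prod J) b →L[ℝ] TangentSpace (I.prod J) b →L[ℝ] ℝ)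
        b (productInner g h b)) := by
  rintro ⟨x₀, y₀⟩
  have hg := g.contMDiff x₀
  have hh := h.contMDiff y₀
  rw [Bundle.contMDiffAt_section] at hg hh ⊢
  have hg' := hg.comp (x₀, y₀) (contMDiffAt_fst (I := I) (J := J))
  have hh' := hh.comp (x₀, y₀) (contMDiffAt_snd (I := I) (J := J))
  have key := (contDiff_sumForm (E := E) (F := F) (n := ∞)).contDiffAt.contMDiffAt.comp (x₀, y₀)
    (hg'.prodMk_space hh')
  refine key.congr_of_eventuallyEq ?_
  have hs : (chartAt H x₀).source ×ˢ (chartAt K y₀).source ∈ 𝓝 (x₀, y₀) :=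
    prod_mem_nhds (chart_source_mem_nhds H x₀) (chart_source_mem_nhds K y₀)
  filter_upwards [hs] with b hb
  obtain ⟨x, y⟩ := b
  refine ContinuousLinearMap.ext fun v ↦ ContinuousLinearMap.ext fun w ↦ ?_
  have e1 := trivializationAt_form_apply (I := I.prod J) (x₀ := (x₀, y₀)) (x := (x, y))
    (by simpa using hb) (productInner g h (x, y)) v w
  have e2 := trivializationAt_form_apply (I := I) hb.1 (g.inner x) v.1 w.1
  have e3 := trivializationAt_form_apply (I := J) hb.2 (h.inner y) v.2 w.2
  refine e1.trans ?_
  rw [symmL_trivializationAt_prod hb.1 hb.2]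
  exact (congrArg₂ (· + ·) e2 e3).symm

/-- The product metric `g ⊕ h` on `M × N`: at `(p, q)` it is
`((v₁, w₁), (v₂, w₂)) ↦ g_p (v₁, v₂) + h_q (w₁, w₂)`, where `T_(p,q) (M × N) = T_p M × T_q N`. -/
def productMetric (g : SmoothMetric I M) (h : SmoothMetric J N) :
    SmoothMetric (I.prod J) (M × N) where
  inner b := productInner g h b
  symm b v w := congrArg₂ (· + ·) (g.symm b.1 v.1 w.1) (h.symm b.2 v.2 w.2)
  pos b v hv := by
    change 0 < g.inner b.1 v.1 v.1 + h.inner b.2 v.2 v.2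
    by_cases h1 : v.1 = 0
    · have h2 : v.2 ≠ 0 := fun h2 ↦ hv (Prod.ext h1 h2)
      exact add_pos_of_nonneg_of_pos (metric_self_nonneg g _ _) (h.pos b.2 _ h2)
    · exact add_pos_of_pos_of_nonneg (g.pos b.1 _ h1) (metric_self_nonneg h _ _)
  isVonNBounded := isVonNBounded_productInner g h
  contMDiff := contMDiff_productInner g h

end RiemannianProduct

end

noncomputable section

namespace RiemannianProduct

variable
  {E : Type*} [NormedAddCommGroup E] [NormedSpace ℝ E]
  {H : Type*} [TopologicalSpace H] {I : ModelWithCorners ℝ E H}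
  {M : Type*} [TopologicalSpace M] [ChartedSpace H M] [IsManifold I ∞ M]
  {F : Type*} [NormedAddCommGroup F] [NormedSpace ℝ F]
  {K : Type*} [TopologicalSpace K] {J : ModelWithCorners ℝ F K}
  {N : Type*} [TopologicalSpace N] [ChartedSpace K N] [IsManifold J ∞ N]

set_option maxSynthPendingDepth 3

/-! ### Metrics on open subsets of a vector space -/

/-! In a product chart the product metric is block diagonal, and each block depends only on its own
variable. Hence Christoffel symbols and curvature split, and `curvatureForm_productMetric` gives
`R(v, w, w, v) = R_M(v₁, w₁, w₁, v₁) + R_N(v₂, w₂, w₂, v₂)`. A plane may project to dependent pairs,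
so the bounds are used with denominators cleared, `R(v, w, w, v) ≤ κ |v ∧ w|²`
(`SectionalCurvatureLE.curvatureForm_le`); for dependent vectors the left side is zero. It remains
to see `|v₁ ∧ w₁|² + |v₂ ∧ w₂|² ≤ |v ∧ w|²` (`areaSq_add_le_areaSq_productMetric`), which follows
from Cauchy–Schwarz in each factor and AM-GM. Multiplying by `max κM κN` uses that it is
nonnegative. -/

theorem christoffel_smul_left (G : E → E →L[ℝ] E →L[ℝ] ℝ) (u : E) (a : ℝ) (v w : E) :
    christoffel G u (a • v) w = a • christoffel G u v w := by
  simp only [christoffel]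
  rw [← map_smul, smul_comm a]
  congr 2
  ext z
  simp
  ring

theorem christoffel_smul_right (G : E → E →L[ℝ] E →L[ℝ] ℝ) (u : E) (a : ℝ) (v w : E) :
    christoffel G u v (a • w) = a • christoffel G u v w := by
  simp only [christoffel]
  rw [← map_smul, smul_comm a]
  congr 2
  ext z
  simp
  ring

theorem coordCurvature_swap (G : E → E →L[ℝ] E →L[ℝ] ℝ) (u v w z : E) :
    coordCurvature G u v w z = -coordCurvature G u w v z := by
  simp only [coordCurvature]
  abel

theorem eventually_isInvertible [CompleteSpace E] {G : E → E →L[ℝ] E →L[ℝ] ℝ} {u : E}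
    (hG : ContinuousAt G u) (hi : (G u).IsInvertible) : ∀ᶠ x in 𝓝 u, (G x).IsInvertible := by
  obtain ⟨e, he⟩ := hi
  have h := ContinuousLinearEquiv.nhds e
  rw [he] at h
  exact hG h

theorem differentiableAt_christoffel [CompleteSpace E] {G : E → E →L[ℝ] E →L[ℝ] ℝ} {u : E}
    (hG : ContDiffAt ℝ 2 G u) (hi : (G u).IsInvertible) (v w : E) :
    DifferentiableAt ℝ (fun x ↦ christoffel G x v w) u := by
  have h1 : DifferentiableAt ℝ (fun x ↦ (G x).inverse) u :=
    ((hi.contDiffAt_map_inverse (n := 2)).comp u hG).differentiableAt two_ne_zero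
  have h2 : DifferentiableAt ℝ (fderiv ℝ G) u :=
    (hG.fderiv_right (m := 1) (by norm_num)).differentiableAt one_ne_zero
  have h4 : DifferentiableAt ℝ (fun x ↦ ((fderiv ℝ G x).flip v).flip w) u :=
    (differentiableAt_const ((ContinuousLinearMap.apply ℝ ℝ w).comp
      (ContinuousLinearMap.apply ℝ (E →L[ℝ] ℝ) v))).clm_comp h2
  have h6 := (h2.clm_apply (differentiableAt_const v)).clm_apply (differentiableAt_const w)
  have h7 := (h2.clm_apply (differentiableAt_const w)).clm_apply (differentiableAt_const v)
  exact h1.clm_apply (((h6.add h7).sub h4).const_smul (1 / 2 : ℝ))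

/-- Homogeneity of `Γ` pulls `a` out of every term, derivatives included, and the terms cancel in
pairs. This covers planes whose projection to a factor degenerates. -/
theorem coordCurvature_smul_self [CompleteSpace E] {G : E → E →L[ℝ] E →L[ℝ] ℝ} {u : E}
    (hG : ContDiffAt ℝ 2 G u) (hi : (G u).IsInvertible) (a : ℝ) (w z : E) :
    coordCurvature G u (a • w) w z = 0 := by
  have h : fderiv ℝ (fun x ↦ christoffel G x (a • w) z) u =
      a • fderiv ℝ (fun x ↦ christoffel G x w z) u := by
    rw [← fderiv_const_smul (differentiableAt_christoffel hG hi w z)]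
    congr 1
    ext x
    exact christoffel_smul_left ..
  rw [coordCurvature, h]
  simp only [christoffel_smul_left, christoffel_smul_right, map_smul, smul_apply]
  abel

/-! ### Products of metrics on open subsets of vector spaces -/

/-- `sumForm` as a continuous linear map. -/
def sumFormL : (E →L[ℝ] E →L[ℝ] ℝ) × (F →L[ℝ] F →L[ℝ] ℝ) →L[ℝ] E × F →L[ℝ] E × F →L[ℝ] ℝ where
  toFun c := sumForm c.1 c.2
  map_add' c d := by
    ext <;> simp [sumForm_apply]
  map_smul' r c := by
    ext <;> simp [sumForm_apply]
  cont := (contDiff_sumForm (n := 0)).continuous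

theorem fderiv_sumForm {G₁ : E → E →L[ℝ] E →L[ℝ] ℝ} {G₂ : F → F →L[ℝ] F →L[ℝ] ℝ} {u : E × F}
    (h₁ : DifferentiableAt ℝ G₁ u.1) (h₂ : DifferentiableAt ℝ G₂ u.2) (v : E × F) :
    fderiv ℝ (fun x : E × F ↦ sumForm (G₁ x.1) (G₂ x.2)) u v =
      sumForm (fderiv ℝ G₁ u.1 v.1) (fderiv ℝ G₂ u.2 v.2) := by
  have h : HasFDerivAt (Prod.map G₁ G₂) ((fderiv ℝ G₁ u.1).prodMap (fderiv ℝ G₂ u.2)) u :=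
    HasFDerivAt.prodMap u h₁.hasFDerivAt h₂.hasFDerivAt
  exact DFunLike.congr_fun (sumFormL.hasFDerivAt.comp u h).fderiv v

theorem isInvertible_sumForm {a : E →L[ℝ] E →L[ℝ] ℝ} {b : F →L[ℝ] F →L[ℝ] ℝ}
    (ha : a.IsInvertible) (hb : b.IsInvertible) : (sumForm a b).IsInvertible := by
  -- The inverse restricts a functional on `E × F` to each factor and inverts the corresponding
  -- block.
  refine .of_inverse (g := (a.inverse ∘L
    (ContinuousLinearMap.compL ℝ E (E × F) ℝ).flip (.inl ℝ E F)).prod (b.inverse ∘L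
      (ContinuousLinearMap.compL ℝ F (E × F) ℝ).flip (.inr ℝ E F))) ?_ ?_
  · refine ContinuousLinearMap.ext fun l ↦ ContinuousLinearMap.ext fun z ↦ ?_
    simp [sumForm_apply, ha.self_apply_inverse, hb.self_apply_inverse, ← map_add]
  · refine ContinuousLinearMap.ext fun v ↦ ?_
    have h1 : (sumForm a b v).comp (.inl ℝ E F) = a v.1 := by ext; simp [sumForm_apply]
    have h2 : (sumForm a b v).comp (.inr ℝ E F) = b v.2 := by ext; simp [sumForm_apply]
    simp [h1, h2, ha.inverse_apply_self, hb.inverse_apply_self]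

theorem christoffel_congr {G G' : E → E →L[ℝ] E →L[ℝ] ℝ} {u : E} (h : G =ᶠ[𝓝 u] G') (v w : E) :
    christoffel G u v w = christoffel G' u v w := by
  simp only [christoffel, h.fderiv_eq, h.eq_of_nhds]

/-- Curvature depends only on the germ of the metric, so a block form valid on the chart target
suffices. -/
theorem coordCurvature_congr {G G' : E → E →L[ℝ] E →L[ℝ] ℝ} {u : E} (h : G =ᶠ[𝓝 u] G')
    (v w z : E) : coordCurvature G u v w z = coordCurvature G' u v w z := by
  have h' (v w : E) : (fun x ↦ christoffel G x v w) =ᶠ[𝓝 u] fun x ↦ christoffel G' x v w :=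
    h.eventuallyEq_nhds.mono fun x hx ↦ christoffel_congr hx v w
  simp only [coordCurvature, (h' _ _).fderiv_eq, christoffel_congr h]

theorem christoffel_sumForm {G₁ : E → E →L[ℝ] E →L[ℝ] ℝ} {G₂ : F → F →L[ℝ] F →L[ℝ] ℝ} {u : E × F}
    (h₁ : DifferentiableAt ℝ G₁ u.1) (h₂ : DifferentiableAt ℝ G₂ u.2)
    (hi₁ : (G₁ u.1).IsInvertible) (hi₂ : (G₂ u.2).IsInvertible) (v w : E × F) :
    christoffel (fun x : E × F ↦ sumForm (G₁ x.1) (G₂ x.2)) u v w =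
      (christoffel G₁ u.1 v.1 w.1, christoffel G₂ u.2 v.2 w.2) := by
  rw [christoffel, (isInvertible_sumForm hi₁ hi₂).inverse_apply_eq]
  refine ContinuousLinearMap.ext fun z ↦ ?_
  simp [sumForm_apply, christoffel, fderiv_sumForm h₁ h₂, hi₁.self_apply_inverse,
    hi₂.self_apply_inverse]
  ring

theorem coordCurvature_sumForm [CompleteSpace E] [CompleteSpace F]
    {G₁ : E → E →L[ℝ] E →L[ℝ] ℝ} {G₂ : F → F →L[ℝ] F →L[ℝ] ℝ} {u : E × F}
    (h₁ : ContDiffAt ℝ 2 G₁ u.1) (h₂ : ContDiffAt ℝ 2 G₂ u.2)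
    (hi₁ : (G₁ u.1).IsInvertible) (hi₂ : (G₂ u.2).IsInvertible) (v w z : E × F) :
    coordCurvature (fun x : E × F ↦ sumForm (G₁ x.1) (G₂ x.2)) u v w z =
      (coordCurvature G₁ u.1 v.1 w.1 z.1, coordCurvature G₂ u.2 v.2 w.2 z.2) := by
  -- Since `Γ` gets differentiated, its splitting is needed on a neighbourhood of `u`, not only at
  -- `u`.
  have e₁ : ∀ᶠ x in 𝓝 u.1, DifferentiableAt ℝ G₁ x ∧ (G₁ x).IsInvertible :=
    ((h₁.eventually (by decide)).mono fun x hx ↦ hx.differentiableAt two_ne_zero).and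
      (eventually_isInvertible h₁.continuousAt hi₁)
  have e₂ : ∀ᶠ x in 𝓝 u.2, DifferentiableAt ℝ G₂ x ∧ (G₂ x).IsInvertible :=
    ((h₂.eventually (by decide)).mono fun x hx ↦ hx.differentiableAt two_ne_zero).and
      (eventually_isInvertible h₂.continuousAt hi₂)
  have e (v w : E × F) : (fun x ↦ christoffel (fun x : E × F ↦ sumForm (G₁ x.1) (G₂ x.2)) x v w)
      =ᶠ[𝓝 u] Prod.map (fun x ↦ christoffel G₁ x v.1 w.1) (fun x ↦ christoffel G₂ x v.2 w.2) := by
    filter_upwards [continuousAt_fst.eventually e₁, continuousAt_snd.eventually e₂] with x hx₁ hx₂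
    exact christoffel_sumForm hx₁.1 hx₂.1 hx₁.2 hx₂.2 v w
  have d (v w t : E × F) :
      fderiv ℝ (fun x ↦ christoffel (fun x : E × F ↦ sumForm (G₁ x.1) (G₂ x.2)) x v w) u t =
        (fderiv ℝ (fun x ↦ christoffel G₁ x v.1 w.1) u.1 t.1,
          fderiv ℝ (fun x ↦ christoffel G₂ x v.2 w.2) u.2 t.2) := by
    rw [(e v w).fderiv_eq, HasFDerivAt.fderiv
      ((differentiableAt_christoffel h₁ hi₁ v.1 w.1).hasFDerivAt.prodMap u
        (differentiableAt_christoffel h₂ hi₂ v.2 w.2).hasFDerivAt)]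
    rfl
  simp only [coordCurvature, d, christoffel_sumForm e₁.self_of_nhds.1 e₂.self_of_nhds.1 hi₁ hi₂]
  rfl

/-! ### The metric in a chart -/

theorem isInvertible_of_self_pos [FiniteDimensional ℝ E] {b : E →L[ℝ] E →L[ℝ] ℝ}
    (hb : ∀ v, v ≠ 0 → 0 < b v v) : b.IsInvertible := by
  have hinj : Function.Injective (b : E →ₗ[ℝ] E →L[ℝ] ℝ) := by
    refine (injective_iff_map_eq_zero _).2 fun v hv ↦ by_contra fun h ↦ (hb v h).ne' ?_
    exact DFunLike.congr_fun (show b v = 0 from hv) v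
  have hdim : Module.finrank ℝ E = Module.finrank ℝ (E →L[ℝ] ℝ) := by
    rw [← (LinearMap.toContinuousLinearMap (𝕜 := ℝ) (E := E) (F' := ℝ)).finrank_eq]
    exact Subspace.dual_finrank_eq.symm
  exact ⟨(LinearMap.linearEquivOfInjective _ hinj hdim).toContinuousLinearEquiv, by ext; rfl⟩

theorem coordMetric_apply (g : SmoothMetric I M) (p : M) (u v w : E) :
    coordMetric g p u v w = g.inner ((extChartAt I p).symm u)
      (mfderiv 𝓘(ℝ, E) I (extChartAt I p).symm u v)
      (mfderiv 𝓘(ℝ, E) I (extChartAt I p).symm u w) := rfl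

theorem isInvertible_mfderiv_extChartAt_symm [I.Boundaryless] {p : M} {u : E}
    (hu : u ∈ (extChartAt I p).target) :
    (mfderiv 𝓘(ℝ, E) I (extChartAt I p).symm u).IsInvertible := by
  have : IsManifold I 1 M := .of_le (n := ∞) (by simp)
  have h := isInvertible_mfderivWithin_extChartAt_symm hu
  rwa [I.range_eq_univ, mfderivWithin_univ] at h

theorem mdifferentiableAt_extChartAt_symm [I.Boundaryless] {p : M} {u : E}
    (hu : u ∈ (extChartAt I p).target) :
    MDifferentiableAt 𝓘(ℝ, E) I (extChartAt I p).symm u := by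
  have : IsManifold I 1 M := .of_le (n := ∞) (by simp)
  have h := mdifferentiableWithinAt_extChartAt_symm (I := I) hu
  rwa [I.range_eq_univ, mdifferentiableWithinAt_univ] at h

theorem isInvertible_coordMetric [FiniteDimensional ℝ E] [I.Boundaryless]
    (g : SmoothMetric I M) {p : M} {u : E} (hu : u ∈ (extChartAt I p).target) :
    (coordMetric g p u).IsInvertible := by
  refine isInvertible_of_self_pos fun v hv ↦ g.pos _ _ fun h ↦ hv ?_
  exact (isInvertible_mfderiv_extChartAt_symm hu).injective (h.trans (map_zero _).symm)

/-- Smoothness of `g` is expressed in bundle trivializations; this identity transfers it to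
`coordMetric`. -/
theorem coordMetric_eq_trivializationAt [I.Boundaryless] (g : SmoothMetric I M) {p : M} {u : E}
    (hu : u ∈ (extChartAt I p).target) :
    coordMetric g p u = (trivializationAt (E →L[ℝ] E →L[ℝ] ℝ)
      (fun x : M ↦ TangentSpace I x →L[ℝ] TangentSpace I x →L[ℝ] ℝ) p
        ⟨(extChartAt I p).symm u, g.inner ((extChartAt I p).symm u)⟩).2 := by
  have hx : (extChartAt I p).symm u ∈ (chartAt H p).source := by
    simpa using (extChartAt I p).map_target hu
  have hd : (trivializationAt E (TangentSpace I) p).symmL ℝ ((extChartAt I p).symm u) =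
      mfderiv 𝓘(ℝ, E) I (extChartAt I p).symm u := by
    rw [TangentBundle.symmL_trivializationAt hx, (extChartAt I p).right_inv hu, I.range_eq_univ,
      mfderivWithin_univ]
  refine ContinuousLinearMap.ext fun v ↦ ContinuousLinearMap.ext fun w ↦ ?_
  refine .trans ?_ (trivializationAt_form_apply hx _ v w).symm
  rw [hd]
  rfl

theorem contDiffAt_coordMetric [I.Boundaryless] (g : SmoothMetric I M) (p : M) :
    ContDiffAt ℝ 2 (coordMetric g p) (extChartAt I p p) := by
  have hg := g.contMDiff p
  rw [Bundle.contMDiffAt_section] at hg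
  have ht : (extChartAt I p).target ∈ 𝓝 (extChartAt I p p) := extChartAt_target_mem_nhds p
  have hs : ContMDiffAt 𝓘(ℝ, E) I ∞ (extChartAt I p).symm (extChartAt I p p) :=
    (contMDiffOn_extChartAt_symm p).contMDiffAt ht
  have h := ContMDiffAt.comp_of_eq hg hs (extChartAt_to_inv p)
  refine ((contMDiffAt_iff_contDiffAt.1 h).of_le (WithTop.coe_le_coe.2 le_top)).congr_of_eventuallyEq ?_
  filter_upwards [ht] with u hu
  exact coordMetric_eq_trivializationAt g hu

theorem curvatureForm_swap (g : SmoothMetric I M) (p : M) (v w z t : TangentSpace I p) :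
    curvatureForm g p v w z t = -curvatureForm g p w v z t := by
  simp only [curvatureForm]
  rw [coordCurvature_swap, map_neg, neg_apply]

theorem curvatureForm_smul_self [FiniteDimensional ℝ E] [I.Boundaryless] (g : SmoothMetric I M)
    (p : M) (a : ℝ) (w z t : TangentSpace I p) : curvatureForm g p (a • w) w z t = 0 := by
  have := FiniteDimensional.complete ℝ E
  let d : E →L[ℝ] E := mfderiv I 𝓘(ℝ, E) (extChartAt I p) p
  have h : coordCurvature (coordMetric g p) (extChartAt I p p) (d (a • w)) (d w) (d z) = 0 := by
    rw [show d (a • w) = a • d w from map_smul d a w]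
    exact coordCurvature_smul_self (contDiffAt_coordMetric g p)
      (isInvertible_coordMetric g (mem_extChartAt_target p)) ..
  change coordMetric g p (extChartAt I p p)
    (coordCurvature (coordMetric g p) (extChartAt I p p) (d (a • w)) (d w) (d z)) (d t) = 0
  rw [h, map_zero, zero_apply]

/-! ### The curvature of a product -/

-- `mfderiv_prodMap` speaks of the product of the models on `E` and `F`, `coordMetric` of the model
-- on `E × F`; the two agree only after rewriting.
omit [IsManifold I ∞ M] [IsManifold J ∞ N] in
theorem mfderiv_modelProd_source (f : E × F → M × N) (u : E × F) :
    mfderiv 𝓘(ℝ, E × F) (I.prod J) f u = mfderiv (𝓘(ℝ, E).prod 𝓘(ℝ, F)) (I.prod J) f u := by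
  rw [modelWithCornersSelf_prod, ← chartedSpaceSelf_prod]

omit [IsManifold I ∞ M] [IsManifold J ∞ N] in
theorem mfderiv_modelProd_target (f : M × N → E × F) (p : M × N) :
    mfderiv (I.prod J) 𝓘(ℝ, E × F) f p = mfderiv (I.prod J) (𝓘(ℝ, E).prod 𝓘(ℝ, F)) f p := by
  rw [modelWithCornersSelf_prod, ← chartedSpaceSelf_prod]

theorem coordMetric_productMetric [I.Boundaryless] [J.Boundaryless] (g : SmoothMetric I M)
    (h : SmoothMetric J N) (p : M × N) {u : E × F} (h₁ : u.1 ∈ (extChartAt I p.1).target)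
    (h₂ : u.2 ∈ (extChartAt J p.2).target) :
    coordMetric (productMetric g h) p u =
      sumForm (coordMetric g p.1 u.1) (coordMetric h p.2 u.2) := by
  have hd : mfderiv 𝓘(ℝ, E × F) (I.prod J) (extChartAt (I.prod J) p).symm u =
      (mfderiv 𝓘(ℝ, E) I (extChartAt I p.1).symm u.1).prodMap
        (mfderiv 𝓘(ℝ, F) J (extChartAt J p.2).symm u.2) := by
    rw [← mfderiv_prodMap (mdifferentiableAt_extChartAt_symm h₁)
      (mdifferentiableAt_extChartAt_symm h₂), extChartAt_prod]
    exact mfderiv_modelProd_source _ u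
  refine ContinuousLinearMap.ext fun v ↦ ContinuousLinearMap.ext fun w ↦ ?_
  rw [coordMetric_apply, hd]
  rfl

theorem curvatureForm_productMetric [FiniteDimensional ℝ E] [FiniteDimensional ℝ F]
    [I.Boundaryless] [J.Boundaryless] (g : SmoothMetric I M) (h : SmoothMetric J N) (p : M × N)
    (v w z t : TangentSpace (I.prod J) p) :
    curvatureForm (productMetric g h) p v w z t =
      curvatureForm g p.1 v.1 w.1 z.1 t.1 + curvatureForm h p.2 v.2 w.2 z.2 t.2 := by
  have := FiniteDimensional.complete ℝ E
  have := FiniteDimensional.complete ℝ F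
  have : IsManifold I 1 M := .of_le (n := ∞) (by simp)
  have : IsManifold J 1 N := .of_le (n := ∞) (by simp)
  have hd : mfderiv (I.prod J) 𝓘(ℝ, E × F) (extChartAt (I.prod J) p) p =
      (mfderiv I 𝓘(ℝ, E) (extChartAt I p.1) p.1).prodMap
        (mfderiv J 𝓘(ℝ, F) (extChartAt J p.2) p.2) := by
    rw [← mfderiv_prodMap (mdifferentiableAt_extChartAt (mem_chart_source H p.1))
      (mdifferentiableAt_extChartAt (mem_chart_source K p.2)), extChartAt_prod]
    exact mfderiv_modelProd_target _ p
  have hG : coordMetric (productMetric g h) p =ᶠ[𝓝 (extChartAt I p.1 p.1, extChartAt J p.2 p.2)]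
      fun u : E × F ↦ sumForm (coordMetric g p.1 u.1) (coordMetric h p.2 u.2) := by
    filter_upwards [prod_mem_nhds (extChartAt_target_mem_nhds p.1)
      (extChartAt_target_mem_nhds p.2)] with u hu
    exact coordMetric_productMetric g h p hu.1 hu.2
  have hu : extChartAt (I.prod J) p p = (extChartAt I p.1 p.1, extChartAt J p.2 p.2) := by
    rw [extChartAt_prod]; rfl
  simp only [curvatureForm]
  rw [hu, hd, coordCurvature_congr hG, hG.eq_of_nhds, coordCurvature_sumForm
    (contDiffAt_coordMetric g p.1)
    (contDiffAt_coordMetric h p.2)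
    (isInvertible_coordMetric g (mem_extChartAt_target p.1))
    (isInvertible_coordMetric h (mem_extChartAt_target p.2))]
  rfl

/-! ### Sectional curvature bounds -/

theorem areaSq_nonneg (g : SmoothMetric I M) (p : M) (v w : TangentSpace I p) :
    0 ≤ areaSq g p v w := by
  -- This vector is `|w|²` times the component of `v` orthogonal to `w`; its squared length is `|w|²
  -- |v ∧ w|²`.
  have h := metric_self_nonneg g p (g.inner p w w • v - g.inner p v w • w)
  have hs := g.symm p w v
  simp only [map_sub, map_smul, sub_apply, smul_apply, smul_eq_mul, hs] at h
  by_cases hw : w = 0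
  · simp [areaSq, hw]
  · refine nonneg_of_mul_nonneg_right (a := g.inner p w w) ?_ (g.pos p w hw)
    rw [areaSq]
    linarith

theorem areaSq_pos (g : SmoothMetric I M) {p : M} {v w : TangentSpace I p}
    (hvw : LinearIndependent ℝ ![v, w]) : 0 < areaSq g p v w := by
  have hw : w ≠ 0 := hvw.ne_zero 1
  have hne : g.inner p w w • v - g.inner p v w • w ≠ 0 := by
    intro h
    have := LinearIndependent.pair_iff.1 hvw (g.inner p w w) (-g.inner p v w)
      (by rw [neg_smul, ← sub_eq_add_neg, h])
    exact (g.pos p w hw).ne' this.1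
  have h := g.pos p _ hne
  have hs := g.symm p w v
  simp only [map_sub, map_smul, sub_apply, smul_apply, smul_eq_mul, hs] at h
  refine pos_of_mul_pos_right (a := g.inner p w w) ?_ (g.pos p w hw).le
  rw [areaSq]
  linarith

theorem areaSq_add_le_areaSq_productMetric (g : SmoothMetric I M) (h : SmoothMetric J N)
    (p : M × N) (v w : TangentSpace (I.prod J) p) :
    areaSq g p.1 v.1 w.1 + areaSq h p.2 v.2 w.2 ≤ areaSq (productMetric g h) p v w := by
  have e (x y : TangentSpace (I.prod J) p) : (productMetric g h).inner p x y =
      g.inner p.1 x.1 y.1 + h.inner p.2 x.2 y.2 := rfl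
  have hg := areaSq_nonneg g p.1 v.1 w.1
  have hh := areaSq_nonneg h p.2 v.2 w.2
  have h1 := metric_self_nonneg g p.1 v.1
  have h2 := metric_self_nonneg g p.1 w.1
  have h3 := metric_self_nonneg h p.2 v.2
  have h4 := metric_self_nonneg h p.2 w.2
  simp only [areaSq, e] at hg hh ⊢
  generalize g.inner p.1 v.1 v.1 = a₁ at *
  generalize g.inner p.1 w.1 w.1 = b₁ at *
  generalize g.inner p.1 v.1 w.1 = c₁ at *
  generalize h.inner p.2 v.2 v.2 = a₂ at *
  generalize h.inner p.2 w.2 w.2 = b₂ at *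
  generalize h.inner p.2 v.2 w.2 = c₂ at *
  -- The right side of the goal minus the left is `a₁ b₂ + a₂ b₁ - 2 c₁ c₂`. Here `4 c₁² c₂² ≤ 4 a₁
  -- b₁ a₂ b₂` by Cauchy–Schwarz, and AM-GM finishes.
  have key : (2 * (c₁ * c₂)) ^ 2 ≤ (a₁ * b₂ + a₂ * b₁) ^ 2 := by
    have := mul_le_mul (sub_nonneg.1 hg) (sub_nonneg.1 hh) (sq_nonneg c₂) (mul_nonneg h1 h2)
    nlinarith [sq_nonneg (a₁ * b₂ - a₂ * b₁)]
  have := abs_le_of_sq_le_sq' key (by positivity)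
  nlinarith [this.2]

theorem SectionalCurvatureLE.curvatureForm_le [FiniteDimensional ℝ E] [I.Boundaryless]
    {g : SmoothMetric I M} {κ : ℝ} (hg : SectionalCurvatureLE g κ) (hκ : 0 ≤ κ) (p : M)
    (v w : TangentSpace I p) : curvatureForm g p v w w v ≤ κ * areaSq g p v w := by
  by_cases hvw : LinearIndependent ℝ ![v, w]
  · exact (div_le_iff₀ (areaSq_pos g hvw)).1 (hg p v w hvw)
  · suffices curvatureForm g p v w w v = 0 from
      this.trans_le (mul_nonneg hκ (areaSq_nonneg g p v w))
    rw [linearIndependent_fin2, not_and_or, not_not, not_forall] at hvw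
    obtain hw | ⟨a, ha⟩ := hvw
    · have hw' : w = (0 : ℝ) • v := by simpa using hw
      rw [curvatureForm_swap, hw', curvatureForm_smul_self, neg_zero]
    · have ha' : v = a • w := by simpa using (not_not.1 ha).symm
      rw [ha', curvatureForm_smul_self]

end RiemannianProduct

end

theorem proposition1
    {E : Type*} [NormedAddCommGroup E] [NormedSpace ℝ E] [FiniteDimensional ℝ E]
    {H : Type*} [TopologicalSpace H] {I : ModelWithCorners ℝ E H} [I.Boundaryless]
    {M : Type*} [TopologicalSpace M] [ChartedSpace H M] [IsManifold I ∞ M]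
    {F : Type*} [NormedAddCommGroup F] [NormedSpace ℝ F] [FiniteDimensional ℝ F]
    {K : Type*} [TopologicalSpace K] {J : ModelWithCorners ℝ F K} [J.Boundaryless]
    {N : Type*} [TopologicalSpace N] [ChartedSpace K N] [IsManifold J ∞ N]
    (gM : RiemannianProduct.SmoothMetric I M) (gN : RiemannianProduct.SmoothMetric J N)
    (κM κN : ℝ) (hκM : 0 ≤ κM) (hκN : 0 ≤ κN)
    (hM : RiemannianProduct.SectionalCurvatureLE gM κM)
    (hN : RiemannianProduct.SectionalCurvatureLE gN κN) :
    RiemannianProduct.SectionalCurvatureLE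
      (RiemannianProduct.productMetric gM gN) (max κM κN) := by
  intro p v w hvw
  refine (div_le_iff₀ (RiemannianProduct.areaSq_pos _ hvw)).2 ?_
  rw [RiemannianProduct.curvatureForm_productMetric]
  calc _ ≤ κM * RiemannianProduct.areaSq gM p.1 v.1 w.1 +
        κN * RiemannianProduct.areaSq gN p.2 v.2 w.2 :=
      add_le_add (hM.curvatureForm_le hκM _ _ _) (hN.curvatureForm_le hκN _ _ _)
    _ ≤ max κM κN * RiemannianProduct.areaSq gM p.1 v.1 w.1 +
        max κM κN * RiemannianProduct.areaSq gN p.2 v.2 w.2 :=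
      add_le_add
        (mul_le_mul_of_nonneg_right (le_max_left _ _) (RiemannianProduct.areaSq_nonneg _ _ _ _))
        (mul_le_mul_of_nonneg_right (le_max_right _ _) (RiemannianProduct.areaSq_nonneg _ _ _ _))
    _ ≤ _ := by
      rw [← mul_add]
      exact mul_le_mul_of_nonneg_left
        (RiemannianProduct.areaSq_add_le_areaSq_productMetric gM gN p v w)
        (hκM.trans (le_max_left _ _))
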